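/- Call a category \emph{large} if it is not equivalent to a small category. For a regular cardinal $\mu$, an object $X$ of a category has \emph{presentability rank} $\mu$ if it is $\mu$-presentable but not $\nu$-presentable for any regular cardinal $\nu<\mu$. An accessible category is \emph{LS-accessible} if there is a cardinal $\lambda$ such that, for every cardinal $\mu\ge\lambda$, it has an object of presentability rank $\mu^+$. \textbf{Theorem.} Every large locally presentable category $\mathcal K$ is LS-accessible. More strongly, let $\lambda$ be any regular cardinal such that $\mathcal K$ is locally $\lambda$-presentable. A \emph{limit theory} of $L_{\lambda\lambda}(\Sigma)$, where $\Sigma$ is an $S$-sorted signature ($S$ a set) whose operation and relation symbols have arity smaller than $\lambda$, is a set of sentences $(\forall x)(\varphi(x)\Rightarrow(\exists!\,y)\,\psi(x,y))$, where $x,y$ are strings of fewer than $\lambda$ sorted variables and $\varphi,\psi$ are conjunctions of fewer than $\lambda$ atomic formulas; $\mathrm{Mod}(T)$ is the category of models of $T$ and homomorphisms. Then: \begin{enumerate} \item $\mathcal K$ is equivalent to $\mathrm{Mod}(T)$ for some $S$, some such $\Sigma$ and some limit theory $T$ of $L_{\lambda\lambda}(\Sigma)$. \item For every such $S,\Sigma,T$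 and every equivalence $E:\mathcal K\to\mathrm{Mod}(T)$, there is a sort $t\in S$ such that the underlying sets $E(K)_t$ of sort $t$, $K\in\mathcal K$, have arbitrarily large cardinality. \item For every such $S,\Sigma,T,E$ and every such sort $t$, the functor $V:\mathcal K\to\mathbf{Set}$, $V(K)=E(K)_t$, has a left adjoint, and each left adjoint $F:\mathbf{Set}\to\mathcal K$ of $V$ preserves presentability ranks $\ge\lambda$: if $\mu\ge\lambda$ is a regular cardinal and a set $X$ has presentability rank $\mu$ in $\mathbf{Set}$, then $F(X)$ has presentability rank $\mu$ in $\mathcal K$. \end{enumerate} -/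

import Mathlib

open CategoryTheory CategoryTheory.Limits

universe w v u v' u'

/-! ### Presentability rank and LS-accessible categories

Throughout, "small" means `w`-small and cardinals are those of the universe `w`. -/

/-- The object `X` has presentability rank `κ`: the cardinal `κ` is regular, `X` is
`κ`-presentable, and `X` is not `μ`-presentable for any regular cardinal `μ < κ`. -/
def HasPresentabilityRank {C : Type u} [Category.{v} C] (X : C) (κ : Cardinal.{w}) : Prop :=
  (∃ _ : Fact κ.IsRegular, IsCardinalPresentable X κ) ∧
    ∀ (μ : Cardinal.{w}) [Fact μ.IsRegular], μ < κ → ¬ IsCardinalPresentable X μ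

/-- An accessible category is `κ`-LS-accessible if it has an object of presentability rank `μ⁺`
for each cardinal `μ ≥ κ`. -/
def IsCardinalLSAccessible (C : Type u) [Category.{v} C] (κ : Cardinal.{w}) : Prop :=
  IsAccessibleCategory.{w} C ∧
    ∀ μ : Cardinal.{w}, κ ≤ μ → ∃ X : C, HasPresentabilityRank X (Order.succ μ)

/-- A category is LS-accessible if it is `κ`-LS-accessible for some cardinal `κ`. -/
def IsLSAccessible (C : Type u) [Category.{v} C] : Prop :=
  ∃ κ : Cardinal.{w}, IsCardinalLSAccessible C κ

/-- The functor `F` preserves presentability ranks `≥ κ`. -/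
def PreservesPresentabilityRanksFrom {C : Type u} [Category.{v} C] {D : Type u'} [Category.{v'} D]
    (F : C ⥤ D) (κ : Cardinal.{w}) : Prop :=
  ∀ (μ : Cardinal.{w}), κ ≤ μ → ∀ X : C,
    HasPresentabilityRank X μ → HasPresentabilityRank (F.obj X) μ

/-- A set-valued functor has arbitrarily large values. -/
def HasArbitrarilyLargeValues {C : Type u} [Category.{v} C] (V : C ⥤ Type w) : Prop :=
  ∀ α : Cardinal.{w}, ∃ X : C, α ≤ Cardinal.mk (V.obj X)

/-! ### Many-sorted infinitary signatures, structures and limit theories -/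

/-- A `κ`-ary `S`-sorted signature: operation and relation symbols, all of arity `< κ`. -/
structure Signature (S : Type w) (κ : Cardinal.{w}) where
  /-- operation symbols -/
  Op : Type w
  /-- the index set of the arguments of an operation symbol -/
  opArity : Op → Type w
  opArity_lt : ∀ f, HasCardinalLT (opArity f) κ
  /-- the sorts of the arguments of an operation symbol -/
  opDom : ∀ f, opArity f → S
  /-- the sort of the value of an operation symbol -/
  opCod : Op → S
  /-- relation symbols -/
  Rel : Type w
  /-- the index set of the arguments of a relation symbol -/
  relArity : Rel → Type w
  relArity_lt : ∀ R, HasCardinalLT (relArity R) κ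
  /-- the sorts of the arguments of a relation symbol -/
  relDom : ∀ R, relArity R → S

namespace Signature

variable {S : Type w} {κ : Cardinal.{w}} (Sg : Signature S κ)

/-- Terms over a string of sorted variables, indexed by their sort. -/
inductive Term {X : Type w} (x : X → S) : S → Type w
  | var (i : X) : Term x (x i)
  | app (f : Sg.Op) (a : ∀ i : Sg.opArity f, Term x (Sg.opDom f i)) : Term x (Sg.opCod f)

/-- Atomic formulas over a string of sorted variables. -/
inductive Atomic {X : Type w} (x : X → S) : Type w
  | eq (s : S) (a b : Sg.Term x s) : Atomic x
  | rel (R : Sg.Rel) (a : ∀ i : Sg.relArity R, Sg.Term x (Sg.relDom R i)) : Atomic x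

/-- Conjunctions of fewer than `κ` atomic formulas. -/
structure Conj {X : Type w} (x : X → S) where
  /-- the index set of the conjunction -/
  Index : Type w
  index_lt : HasCardinalLT Index κ
  /-- the conjuncts -/
  atom : Index → Sg.Atomic x

/-- Limit sentences of `L_{κκ}`: `(∀ x) (φ(x) ⇒ (∃! y) ψ(x, y))`, where `x` and `y` are strings of
fewer than `κ` sorted variables, and `φ`, `ψ` are conjunctions of fewer than `κ` atomic
formulas. -/
structure LimitSentence where
  /-- the index set of the string `x` -/
  X : Type w
  X_lt : HasCardinalLT X κ
  /-- the sorts of the string `x` -/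
  x : X → S
  /-- the index set of the string `y` -/
  Y : Type w
  Y_lt : HasCardinalLT Y κ
  /-- the sorts of the string `y` -/
  y : Y → S
  /-- the formula `φ(x)` -/
  premise : Sg.Conj x
  /-- the formula `ψ(x, y)` -/
  conclusion : Sg.Conj (Sum.elim x y)

/-- Structures for the signature (the underlying sets may be empty). -/
structure Str where
  /-- the underlying sets -/
  carrier : S → Type w
  /-- the interpretation of the operation symbols -/
  op : ∀ f : Sg.Op, (∀ i : Sg.opArity f, carrier (Sg.opDom f i)) → carrier (Sg.opCod f)
  /-- the interpretation of the relation symbols -/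
  rel : ∀ R : Sg.Rel, (∀ i : Sg.relArity R, carrier (Sg.relDom R i)) → Prop

variable {Sg}

namespace Str

/-- Homomorphisms: families of maps preserving all operations and relations. -/
@[ext]
structure Hom (M N : Sg.Str) where
  /-- the underlying maps -/
  toFun : ∀ s, M.carrier s → N.carrier s
  map_op : ∀ (f : Sg.Op) (a : ∀ i : Sg.opArity f, M.carrier (Sg.opDom f i)),
    toFun _ (M.op f a) = N.op f (fun i => toFun _ (a i))
  map_rel : ∀ (R : Sg.Rel) (a : ∀ i : Sg.relArity R, M.carrier (Sg.relDom R i)),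
    M.rel R a → N.rel R (fun i => toFun _ (a i))

/-- The category of structures and homomorphisms. -/
instance : Category.{w} Sg.Str where
  Hom := Hom
  id M :=
    { toFun := fun _ a => a
      map_op := fun _ _ => rfl
      map_rel := fun _ _ h => h }
  comp g h :=
    { toFun := fun s a => h.toFun s (g.toFun s a)
      map_op := fun f a => by rw [g.map_op, h.map_op]
      map_rel := fun R a ha => h.map_rel R _ (g.map_rel R a ha) }

variable (M : Sg.Str)

/-- The value of a term under an assignment of the variables. -/
def eval {X : Type w} {x : X → S} (a : ∀ i, M.carrier (x i)) : ∀ {s : S}, Sg.Term x s → M.carrier s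
  | _, .var i => a i
  | _, .app f b => M.op f (fun i => eval a (b i))

/-- The truth of an atomic formula under an assignment of the variables. -/
def HoldsAtomic {X : Type w} {x : X → S} (a : ∀ i, M.carrier (x i)) : Sg.Atomic x → Prop
  | .eq _ b c => M.eval a b = M.eval a c
  | .rel R b => M.rel R (fun i => M.eval a (b i))

/-- The truth of a conjunction of atomic formulas under an assignment of the variables. -/
def Holds {X : Type w} {x : X → S} (a : ∀ i, M.carrier (x i)) (φ : Sg.Conj x) : Prop :=
  ∀ j : φ.Index, M.HoldsAtomic a (φ.atom j)

/-- The concatenation of an assignment of the string `x` and an assignment of the string `y`. -/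
def append {X Y : Type w} {x : X → S} {y : Y → S} (a : ∀ i, M.carrier (x i))
    (b : ∀ j, M.carrier (y j)) : ∀ k : X ⊕ Y, M.carrier (Sum.elim x y k)
  | .inl i => a i
  | .inr j => b j

/-- The truth of a limit sentence in a structure. -/
def Satisfies (σ : Sg.LimitSentence) : Prop :=
  ∀ a : (∀ i, M.carrier (σ.x i)), M.Holds a σ.premise →
    ∃! b : (∀ j, M.carrier (σ.y j)), M.Holds (M.append a b) σ.conclusion

end Str

/-- The category `Mod(T)` of models of a limit theory `T` and homomorphisms, a full subcategory
of the category of structures. -/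
abbrev Mod (T : Set Sg.LimitSentence) : Type (w + 1) :=
  ObjectProperty.FullSubcategory (fun M : Sg.Str => ∀ σ ∈ T, M.Satisfies σ)

/-- The functor `Mod(T) ⥤ Set` sending a model to its underlying set of sort `t`. -/
def sortProj (T : Set Sg.LimitSentence) (t : S) : Mod T ⥤ Type w where
  obj M := M.obj.carrier t
  map h := TypeCat.ofHom (h.hom.toFun t)

end Signature

/-! Presentability ranks are transported from sets, where an infinite set of cardinality `μ` has
rank `μ⁺`, along a left adjoint `F` of an underlying-set functor `V`. If `V` preserves `κ`-filtered
colimits, then `F` preserves `μ`-presentability for every regular `μ ≥ κ`. Conversely, if some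
`V(K)` has two elements, maps into `V(K)` separate the points of a set from its proper subsets; this
forces `|X| < ν` as soon as `F(X)` is `ν`-presentable
(`hasCardinalLT_of_isCardinalPresentable_leftAdjoint_obj`). So ranks can neither rise nor drop.

Such a `V` is obtained from a presentation by a limit theory. Take as sorts the `κ`-presentable
objects, up to equivalence, and require presheaves on them to turn `κ`-small colimits into limits;
density and presentability make the nerve an equivalence (`presheafSignature.essSurj_nerve`). For
any limit theory, limits and `κ`-filtered colimits of models are computed on underlying sets,
because unique solutions are compatible with homomorphisms and formulas involve fewer than `κ` data.
The adjoint functor theorem then gives `F`. Largeness enters only through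
`Signature.essentiallySmall_mod`: if every sort were bounded, there would be only a small set of
models up to isomorphism. -/

/-! ### Adjunctions with a set-valued right adjoint -/

section Adjunction

variable {C : Type u} [Category.{v} C]

/-- If `F` is left adjoint to a set-valued functor with a value having at least two elements, then
`F` reflects presentability. -/
lemma hasCardinalLT_of_isCardinalPresentable_leftAdjoint_obj {F : Type w ⥤ C} {V : C ⥤ Type w}
    (adj : F ⊣ V) {K : C} [Nontrivial (V.obj K)] (ν : Cardinal.{w}) [Fact ν.IsRegular]
    (X : Type w) [IsCardinalPresentable (F.obj X) ν] : HasCardinalLT X ν := by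
  have hν : Cardinal.aleph0 ≤ ν := (Fact.out : ν.IsRegular).aleph0_le
  have : F.IsLeftAdjoint := adj.isLeftAdjoint
  have := essentiallySmallSelf (HasCardinalLT.Set X ν)
  obtain ⟨A, f, hf⟩ := IsCardinalPresentable.exists_hom_of_isColimit (X := F.obj X) ν
    (isColimitOfPreserves F (HasCardinalLT.Set.isColimitCocone X ν hν)) (𝟙 (F.obj X))
  by_cases hA : A.val = Set.univ
  · have hA' := A.prop
    rw [hA] at hA'
    exact hA'.of_injective (fun x => ⟨x, trivial⟩) (fun x y h => congrArg Subtype.val h)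
  · exfalso
    obtain ⟨x, hx⟩ := (Set.ne_univ_iff_exists_notMem _).1 hA
    obtain ⟨a, b, hab⟩ := exists_pair_ne (V.obj K)
    classical
    -- These maps differ only at `x`, which lies outside `A`. Their transposes agree after `F.map
    -- ι`, a split epimorphism with section `f`, and hence would coincide.
    let g₁ : X ⟶ V.obj K := TypeCat.ofHom (fun _ => a)
    let g₂ : X ⟶ V.obj K := TypeCat.ofHom (fun y => if y = x then b else a)
    let ι : (HasCardinalLT.Set.functor X ν).obj A ⟶ X := (HasCardinalLT.Set.cocone X ν).ι.app A
    have key : F.map ι ≫ (adj.homEquiv X K).symm g₁ = F.map ι ≫ (adj.homEquiv X K).symm g₂ := by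
      rw [← adj.homEquiv_naturality_left_symm, ← adj.homEquiv_naturality_left_symm]
      congr 1
      ext ⟨y, hy⟩
      have : y ≠ x := fun h => hx (h ▸ hy)
      change a = if y = x then b else a
      rw [if_neg this]
    have key' : (adj.homEquiv X K).symm g₁ = (adj.homEquiv X K).symm g₂ := by
      have h := congrArg (fun t => f ≫ t) key
      have hf' : f ≫ F.map ι = 𝟙 _ := hf
      rwa [← Category.assoc, ← Category.assoc, hf', Category.id_comp, Category.id_comp] at h
    have h := ConcreteCategory.congr_hom ((adj.homEquiv X K).symm.injective key') x
    simp only [g₁, g₂, ConcreteCategory.hom_ofHom, TypeCat.Fun.coe_mk, if_true] at h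
    exact hab h

/-- A left adjoint of a `κ`-accessible set-valued functor with a value having at least two elements
preserves presentability ranks `≥ κ`. -/
lemma preservesPresentabilityRanksFrom_of_adjunction {F : Type w ⥤ C} {V : C ⥤ Type w}
    (adj : F ⊣ V) {K : C} [Nontrivial (V.obj K)] (κ : Cardinal.{w}) [Fact κ.IsRegular]
    [V.IsCardinalAccessible κ] : PreservesPresentabilityRanksFrom F κ := by
  rintro μ hμ X ⟨⟨hreg, hX⟩, hX'⟩
  refine ⟨⟨hreg, ?_⟩, fun ν _ hν h => hX' ν hν ?_⟩
  · have := V.isCardinalAccessible_of_le hμ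
    exact adj.isCardinalPresentable_leftAdjoint_obj μ X
  · exact (hasCardinalLT_of_isCardinalPresentable_leftAdjoint_obj adj (K := K) ν
      X).isCardinalPresentable

lemma hasPresentabilityRank_type_succ (X : Type w) (hX : Cardinal.aleph0 ≤ Cardinal.mk X) :
    HasPresentabilityRank X (Order.succ (Cardinal.mk X)) := by
  have hreg : Fact (Order.succ (Cardinal.mk X)).IsRegular := ⟨Cardinal.isRegular_succ hX⟩
  refine ⟨⟨hreg, ?_⟩, fun ν _ hν h => ?_⟩
  · rw [Types.isCardinalPresentable_iff, hasCardinalLT_iff_cardinal_mk_lt]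
    exact Order.lt_succ _
  · rw [Types.isCardinalPresentable_iff, hasCardinalLT_iff_cardinal_mk_lt] at h
    exact (Order.lt_succ_iff.1 hν).not_gt h

lemma HasArbitrarilyLargeValues.exists_nontrivial {V : C ⥤ Type w}
    (hV : HasArbitrarilyLargeValues V) : ∃ K : C, Nontrivial (V.obj K) := by
  obtain ⟨K, hK⟩ := hV 2
  exact ⟨K, Cardinal.one_lt_iff_nontrivial.1 (lt_of_lt_of_le (by norm_num) hK)⟩

end Adjunction

/-! ### The solution set condition -/

/-- An accessible set-valued functor on a locally presentable category satisfies the solution set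
condition. -/
lemma solutionSetCondition_of_isCardinalAccessible {D : Type u} [Category.{v} D]
    (κ : Cardinal.{w}) [Fact κ.IsRegular] [IsCardinalLocallyPresentable D κ]
    (V : D ⥤ Type w) [V.IsCardinalAccessible κ] : SolutionSetCondition.{w} V := by
  intro A
  -- Raising the index above both `κ` and the cardinality of `A` makes `A` a `κ'`-presentable set,
  -- while accessibility of `V` and local presentability of `D` persist.
  obtain ⟨κ', hκ', h⟩ := HasCardinalLT.exists_regular_cardinal_forall.{w}
    (Sum.elim (fun _ : PUnit.{w + 1} => A) (fun _ : PUnit.{w + 1} => κ.out))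
  have : Fact κ'.IsRegular := ⟨hκ'⟩
  have hA : HasCardinalLT A κ' := h (.inl ⟨⟩)
  have hle : κ ≤ κ' := by
    have := h (.inr ⟨⟩)
    simp only [Sum.elim_inr, hasCardinalLT_iff_cardinal_mk_lt, Cardinal.mk_out] at this
    exact this.le
  have := V.isCardinalAccessible_of_le hle
  have := IsCardinalLocallyPresentable.of_le D hle
  have := hA.isCardinalPresentable
  obtain ⟨P, _, hP⟩ := HasCardinalFilteredGenerator.exists_small_generator D κ'
  let B (i : Shrink.{w} (Subtype P)) : D := ((equivShrink (Subtype P)).symm i).1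
  refine ⟨Σ i : Shrink.{w} (Subtype P), (A ⟶ V.obj (B i)), fun i => B i.1, fun i => i.2,
    fun X g => ?_⟩
  obtain ⟨J, _, _, ⟨p⟩⟩ := hP.exists_colimitsOfShape X
  have := essentiallySmallSelf J
  have := V.preservesColimitsOfShape_of_isCardinalAccessible κ' J
  -- `X` is a `κ'`-filtered colimit of generators and `V` preserves it, so `g` factors through the
  -- value of `V` at a generator; maps from `A` to such values form the solution set.
  obtain ⟨j, f, hf⟩ := IsCardinalPresentable.exists_hom_of_isColimit κ'
    (isColimitOfPreserves V p.isColimit) g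
  obtain ⟨i, hi⟩ : ∃ i, B i = p.diag.obj j :=
    ⟨equivShrink _ ⟨_, p.prop_diag_obj j⟩, by simp [B]⟩
  refine ⟨⟨i, f ≫ V.map (eqToHom hi.symm)⟩, eqToHom hi ≫ p.ι.app j, ?_⟩
  have hf' : f ≫ V.map (p.ι.app j) = g := hf
  simp [← hf', ← Functor.map_comp]

namespace Signature

variable {S : Type w} {κ : Cardinal.{w}} {Sg : Signature S κ}

namespace Str

/-! ### Homomorphisms and formulas -/

lemma Hom.map_eval {M N : Sg.Str} (h : M ⟶ N) {X : Type w} {x : X → S}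
    (a : ∀ i, M.carrier (x i)) {s : S} (t : Sg.Term x s) :
    h.toFun s (M.eval a t) = N.eval (fun i => h.toFun _ (a i)) t := by
  induction t with
  | var i => rfl
  | app f b ih =>
    simp only [eval]
    rw [h.map_op]
    congr 1
    funext i
    exact ih i

lemma Hom.map_holdsAtomic {M N : Sg.Str} (h : M ⟶ N) {X : Type w} {x : X → S}
    {a : ∀ i, M.carrier (x i)} {φ : Sg.Atomic x} (hφ : M.HoldsAtomic a φ) :
    N.HoldsAtomic (fun i => h.toFun _ (a i)) φ := by
  cases φ with
  | eq s b c =>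
    simp only [HoldsAtomic] at hφ ⊢
    rw [← Hom.map_eval, ← Hom.map_eval, hφ]
  | rel R b =>
    simp only [HoldsAtomic] at hφ ⊢
    simpa only [Hom.map_eval] using h.map_rel R _ hφ

lemma Hom.map_holds {M N : Sg.Str} (h : M ⟶ N) {X : Type w} {x : X → S}
    {a : ∀ i, M.carrier (x i)} {φ : Sg.Conj x} (hφ : M.Holds a φ) :
    N.Holds (fun i => h.toFun _ (a i)) φ :=
  fun j => Hom.map_holdsAtomic h (hφ j)

lemma Hom.map_append {M N : Sg.Str} (h : M ⟶ N) {X Y : Type w} {x : X → S} {y : Y → S}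
    (a : ∀ i, M.carrier (x i)) (b : ∀ j, M.carrier (y j)) :
    (fun k => h.toFun _ (M.append a b k)) =
      N.append (fun i => h.toFun _ (a i)) (fun j => h.toFun _ (b j)) := by
  funext k
  cases k <;> rfl

lemma Hom.map_holds_append {M N : Sg.Str} (h : M ⟶ N) {X Y : Type w} {x : X → S} {y : Y → S}
    {a : ∀ i, M.carrier (x i)} {b : ∀ j, M.carrier (y j)} {φ : Sg.Conj (Sum.elim x y)}
    (hφ : M.Holds (M.append a b) φ) :
    N.Holds (N.append (fun i => h.toFun _ (a i)) (fun j => h.toFun _ (b j))) φ := by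
  rw [← Hom.map_append]
  exact Hom.map_holds h hφ

@[simp]
lemma id_toFun (M : Sg.Str) (s : S) (a : M.carrier s) : Hom.toFun (𝟙 M) s a = a := rfl

@[simp]
lemma comp_toFun {M N P : Sg.Str} (g : M ⟶ N) (h : N ⟶ P) (s : S) (a : M.carrier s) :
    Hom.toFun (g ≫ h) s a = h.toFun s (g.toFun s a) := rfl

@[ext]
lemma hom_ext {M N : Sg.Str} {g h : M ⟶ N} (H : ∀ s a, g.toFun s a = h.toFun s a) : g = h :=
  Hom.ext (funext fun s => funext fun a => H s a)

lemma map_comp_toFun {J : Type*} [Category J] (D : J ⥤ Sg.Str) {i j k : J} (f : i ⟶ j) (g : j ⟶ k)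
    (s : S) (a : (D.obj i).carrier s) :
    (D.map (f ≫ g)).toFun s a = (D.map g).toFun s ((D.map f).toFun s a) := by
  rw [D.map_comp, comp_toFun]

/-- A jointly injective family of homomorphisms that jointly reflects the relations jointly reflects
conjunctions of atomic formulas. -/
lemma holds_of_forall {ι : Type*} {M : Sg.Str} {N : ι → Sg.Str} (p : ∀ j, M ⟶ N j)
    (hinj : ∀ s (a b : M.carrier s), (∀ j, (p j).toFun s a = (p j).toFun s b) → a = b)
    (hrel : ∀ R (a : ∀ i : Sg.relArity R, M.carrier (Sg.relDom R i)),
      (∀ j, (N j).rel R (fun i => (p j).toFun _ (a i))) → M.rel R a)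
    {X : Type w} {x : X → S} {a : ∀ i, M.carrier (x i)} {φ : Sg.Conj x}
    (h : ∀ j, (N j).Holds (fun i => (p j).toFun _ (a i)) φ) : M.Holds a φ := by
  intro i
  replace h := fun j => h j i
  generalize φ.atom i = ψ at h
  cases ψ with
  | eq s b c =>
    simp only [HoldsAtomic] at h ⊢
    exact hinj s _ _ fun j => by rw [Hom.map_eval, Hom.map_eval, h]
  | rel R b =>
    simp only [HoldsAtomic] at h ⊢
    exact hrel R _ fun j => by simpa only [Hom.map_eval] using h j

/-- The functor sending a structure to its underlying set of sort `t`. -/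
def sort (Sg : Signature S κ) (t : S) : Sg.Str ⥤ Type w where
  obj M := M.carrier t
  map h := TypeCat.ofHom (h.toFun t)

/-! ### Limits of structures -/

section Limits

variable {J : Type w} [SmallCategory J] (D : J ⥤ Sg.Str)

/-- The limit of a diagram of structures, computed on underlying sets. -/
def limitStr : Sg.Str where
  carrier s := { x : ∀ j, (D.obj j).carrier s // ∀ ⦃i j : J⦄ (f : i ⟶ j),
    (D.map f).toFun s (x i) = x j }
  op f a := ⟨fun j => (D.obj j).op f (fun i => (a i).1 j), fun i j g => by
    rw [(D.map g).map_op]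
    congr 1
    funext k
    exact (a k).2 g⟩
  rel R a := ∀ j, (D.obj j).rel R (fun i => (a i).1 j)

/-- The projections of the limit structure. -/
def limitStrπ (j : J) : limitStr D ⟶ D.obj j where
  toFun _ x := x.1 j
  map_op _ _ := rfl
  map_rel _ _ h := h j

/-- The limit cone of a diagram of structures. -/
def limitStrCone : Cone D where
  pt := limitStr D
  π :=
    { app := limitStrπ D
      naturality := fun _ _ f => hom_ext fun _ x => (x.2 f).symm }

/-- The cone `limitStrCone` is a limit cone. -/
def isLimitLimitStrCone : IsLimit (limitStrCone D) where
  lift c :=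
    { toFun := fun s x => ⟨fun j => (c.π.app j).toFun s x, fun i j f => by
        rw [← comp_toFun, c.w]⟩
      map_op := fun f a => Subtype.ext (funext fun j => (c.π.app j).map_op f a)
      map_rel := fun R a h j => (c.π.app j).map_rel R a h }
  fac _ _ := rfl
  uniq c m hm := hom_ext fun s x => Subtype.ext (funext fun j =>
    congrArg (fun h : c.pt ⟶ D.obj j => h.toFun s x) (hm j))

/-- The functors `sort` preserve the limits `limitStrCone`. -/
lemma nonempty_isLimit_sort_mapCone (t : S) :
    Nonempty (IsLimit ((sort Sg t).mapCone (limitStrCone D))) := by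
  rw [Types.isLimit_iff]
  intro x hx
  refine ⟨⟨x, fun i j f => hx f⟩, fun j => rfl, fun y hy => Subtype.ext (funext fun j => hy j)⟩

/-- The transition maps carry solutions to solutions, so uniqueness forces the solutions at the
various stages to be compatible. They therefore assemble into a point of the limit, unique because
it is so at each stage. -/
lemma satisfies_limitStr {σ : Sg.LimitSentence} (hσ : ∀ j, (D.obj j).Satisfies σ) :
    (limitStr D).Satisfies σ := by
  intro a ha
  choose b hb hb' using fun j => hσ j _ (Hom.map_holds (limitStrπ D j) ha)
  have hbD (i j : J) (f : i ⟶ j) : (fun k => (D.map f).toFun _ (b i k)) = b j := by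
    apply hb'
    have := Hom.map_holds_append (D.map f) (hb i)
    convert this using 2
    funext k
    exact ((a k).2 f).symm
  let B (k : σ.Y) : (limitStr D).carrier (σ.y k) :=
    ⟨fun j => b j k, fun i j f => congrFun (hbD i j f) k⟩
  refine ⟨B, ?_, fun b' h => ?_⟩
  · refine holds_of_forall (limitStrπ D) (fun s x y h => Subtype.ext (funext h))
      (fun R a h => h) fun j => ?_
    have := Hom.map_append (limitStrπ D j) a B
    rw [this]
    exact hb j
  · funext k
    refine Subtype.ext (funext fun j => ?_)
    exact congrFun (hb' j _ (Hom.map_holds_append (limitStrπ D j) h)) k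

end Limits

end Str

section Limits

variable (T : Set Sg.LimitSentence)

lemma hasLimits_and_preservesLimits (J : Type w) [SmallCategory J] (F : J ⥤ Mod T) :
    HasLimit F ∧ ∀ t, PreservesLimit F (sortProj T t) := by
  let D : J ⥤ Sg.Str := F ⋙ ObjectProperty.ι _
  let L : Mod T := ⟨Str.limitStr D, fun σ hσ =>
    Str.satisfies_limitStr D fun j => (F.obj j).property σ hσ⟩
  let c : Cone F :=
    { pt := L
      π :=
        { app := fun j => ObjectProperty.homMk (Str.limitStrπ D j)
          naturality := fun i j f => by
            ext : 1
            exact (Str.limitStrCone D).π.naturality f } }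
  have hc : IsLimit c := isLimitOfReflects (ObjectProperty.ι _)
    (show IsLimit ((ObjectProperty.ι _).mapCone c) from Str.isLimitLimitStrCone D)
  refine ⟨⟨⟨c, hc⟩⟩, fun t => ?_⟩
  exact preservesLimit_of_preserves_limit_cone hc (Str.nonempty_isLimit_sort_mapCone D t).some

instance : HasLimits (Mod T) where
  has_limits_of_shape J _ := ⟨fun F => (hasLimits_and_preservesLimits T J F).1⟩

instance (t : S) : PreservesLimits (sortProj T t) where
  preservesLimitsOfShape {J _} := ⟨fun {F} => (hasLimits_and_preservesLimits T J F).2 t⟩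

end Limits

end Signature

namespace Signature

variable {S : Type w} {κ : Cardinal.{w}} {Sg : Signature S κ}

namespace Str

/-! ### Filtered colimits of structures -/

section Colimits

variable {J : Type w} [SmallCategory J] (D : J ⥤ Sg.Str)

/-- The underlying sets of the colimit of a filtered diagram of structures. -/
noncomputable abbrev ColimCarrier (s : S) : Type w := colimit (D ⋙ sort Sg s)

/-- The maps to the underlying sets of the colimit of a filtered diagram of structures. -/
noncomputable def colimMk (j : J) {s : S} (a : (D.obj j).carrier s) : ColimCarrier D s :=
  colimit.ι (D ⋙ sort Sg s) j a

lemma colimMk_map {i j : J} (f : i ⟶ j) {s : S} (a : (D.obj i).carrier s) :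
    colimMk D j ((D.map f).toFun s a) = colimMk D i a :=
  ConcreteCategory.congr_hom (colimit.w (D ⋙ sort Sg s) f) a

lemma exists_colimMk_eq {s : S} (a : ColimCarrier D s) :
    ∃ (j : J) (b : (D.obj j).carrier s), colimMk D j b = a :=
  Types.jointly_surjective_of_isColimit (colimit.isColimit (D ⋙ sort Sg s)) a

variable [hκ : Fact κ.IsRegular] [IsCardinalFiltered J κ]

include hκ

omit hκ [IsCardinalFiltered J κ] in
lemma exists_map_eq_of_colimMk_eq [IsFiltered J] {j : J} {s : S} {a b : (D.obj j).carrier s}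
    (h : colimMk D j a = colimMk D j b) :
    ∃ (k : J) (f : j ⟶ k), (D.map f).toFun s a = (D.map f).toFun s b :=
  (Types.FilteredColimit.isColimit_eq_iff' (colimit.isColimit (D ⋙ sort Sg s)) a b).1 h

/-- Fewer than `κ` equalities, each valid at some later stage, hold together at one stage by
`κ`-filteredness. This is where the bounds on arities and on strings of variables are used. -/
lemma exists_family_map_eq {X : Type w} (hX : HasCardinalLT X κ) {x : X → S} {j : J}
    {a b : ∀ i, (D.obj j).carrier (x i)} (h : ∀ i, colimMk D j (a i) = colimMk D j (b i)) :
    ∃ (k : J) (f : j ⟶ k), ∀ i, (D.map f).toFun _ (a i) = (D.map f).toFun _ (b i) := by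
  have := isFiltered_of_isCardinalFiltered J κ
  choose k f hf using fun i => exists_map_eq_of_colimMk_eq D (h i)
  obtain ⟨m, g, g', hg⟩ := IsCardinalFiltered.wideSpan f hX
  exact ⟨m, g', fun i => by rw [← hg i, map_comp_toFun, map_comp_toFun, hf]⟩

lemma exists_family_colimMk_eq {X : Type w} (hX : HasCardinalLT X κ) {x : X → S}
    (a : ∀ i, ColimCarrier D (x i)) :
    ∃ (j : J) (b : ∀ i, (D.obj j).carrier (x i)), ∀ i, colimMk D j (b i) = a i := by
  choose j b hb using fun i => exists_colimMk_eq D (a i)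
  exact ⟨IsCardinalFiltered.max j hX,
    fun i => (D.map (IsCardinalFiltered.toMax j hX i)).toFun _ (b i),
    fun i => by rw [colimMk_map, hb]⟩

lemma exists_family_map_eq_map {X : Type w} (hX : HasCardinalLT X κ) {x : X → S} {j j' : J}
    {a : ∀ i, (D.obj j).carrier (x i)} {b : ∀ i, (D.obj j').carrier (x i)}
    (h : ∀ i, colimMk D j (a i) = colimMk D j' (b i)) :
    ∃ (k : J) (f : j ⟶ k) (g : j' ⟶ k),
      ∀ i, (D.map f).toFun _ (a i) = (D.map g).toFun _ (b i) := by
  have := isFiltered_of_isCardinalFiltered J κ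
  obtain ⟨k, f, hf⟩ := exists_family_map_eq D hX
    (a := fun i => (D.map (IsFiltered.leftToMax j j')).toFun _ (a i))
    (b := fun i => (D.map (IsFiltered.rightToMax j j')).toFun _ (b i))
    (fun i => by rw [colimMk_map, colimMk_map, h])
  exact ⟨k, IsFiltered.leftToMax j j' ≫ f, IsFiltered.rightToMax j j' ≫ f,
    fun i => by rw [map_comp_toFun, map_comp_toFun, hf]⟩

/-- The colimit of a `κ`-filtered diagram of structures, computed on underlying sets. -/
noncomputable def colimStr : Sg.Str where
  carrier s := ColimCarrier D s
  op f a := colimMk D (exists_family_colimMk_eq D (Sg.opArity_lt f) a).choose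
    ((D.obj _).op f (exists_family_colimMk_eq D (Sg.opArity_lt f) a).choose_spec.choose)
  rel R a := ∃ (j : J) (b : ∀ i, (D.obj j).carrier (Sg.relDom R i)),
    (∀ i, colimMk D j (b i) = a i) ∧ (D.obj j).rel R b

/-- The operations of `colimStr` use chosen representatives; two families of representatives of the
same arguments become equal at a later stage, so the choice is immaterial. -/
lemma colimStr_op (f : Sg.Op) {j : J} (a : ∀ i, (D.obj j).carrier (Sg.opDom f i)) :
    (colimStr D).op f (fun i => colimMk D j (a i)) = colimMk D j ((D.obj j).op f a) := by
  have H := exists_family_colimMk_eq D (Sg.opArity_lt f) (fun i => colimMk D j (a i))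
  change colimMk D H.choose ((D.obj _).op f H.choose_spec.choose) = _
  have h := H.choose_spec.choose_spec
  generalize H.choose_spec.choose = b at h
  obtain ⟨k, g, g', hg⟩ := exists_family_map_eq_map D (Sg.opArity_lt f) h
  rw [← colimMk_map D g, ← colimMk_map D g', (D.map g).map_op, (D.map g').map_op]
  congr 2
  funext i
  exact hg i

/-- The homomorphisms to the colimit of a `κ`-filtered diagram of structures. -/
noncomputable def colimStrι (j : J) : D.obj j ⟶ colimStr D where
  toFun _ a := colimMk D j a
  map_op f a := (colimStr_op D f a).symm
  map_rel _ a h := ⟨j, a, fun _ => rfl, h⟩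

/-- The colimit cocone of a `κ`-filtered diagram of structures. -/
noncomputable def colimStrCocone : Cocone D where
  pt := colimStr D
  ι :=
    { app := colimStrι D
      naturality := fun _ _ f => hom_ext fun _ a => colimMk_map D f a }

/-- The maps from the underlying sets of the colimit induced by a cocone of structures. -/
noncomputable def colimDesc (c : Cocone D) (s : S) (a : ColimCarrier D s) : c.pt.carrier s :=
  colimit.desc (D ⋙ sort Sg s) ((sort Sg s).mapCocone c) a

omit hκ [IsCardinalFiltered J κ] in
lemma colimDesc_colimMk (c : Cocone D) {s : S} {j : J} (a : (D.obj j).carrier s) :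
    colimDesc D c s (colimMk D j a) = (c.ι.app j).toFun s a :=
  ConcreteCategory.congr_hom (colimit.ι_desc ((sort Sg s).mapCocone c) j) a

/-- The cocone `colimStrCocone` is a colimit cocone. -/
noncomputable def isColimitColimStrCocone : IsColimit (colimStrCocone D) where
  desc c :=
    { toFun := colimDesc D c
      map_op := fun f a => by
        obtain ⟨j, b, hb⟩ := exists_family_colimMk_eq D (Sg.opArity_lt f) a
        obtain rfl : (fun i => colimMk D j (b i)) = a := funext hb
        have h := colimStr_op D f b
        change colimDesc D c _ ((colimStr D).op f _) = _
        rw [h, colimDesc_colimMk, (c.ι.app j).map_op]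
        simp only [colimDesc_colimMk]
        rfl
      map_rel := by
        rintro R a ⟨j, b, hb, h⟩
        obtain rfl : (fun i => colimMk D j (b i)) = a := funext hb
        simp only [colimDesc_colimMk]
        exact (c.ι.app j).map_rel R b h }
  fac c j := hom_ext fun s a => colimDesc_colimMk D c a
  uniq c m hm := hom_ext fun s a => by
    obtain ⟨j, b, rfl⟩ := exists_colimMk_eq D a
    exact (congrArg (fun h : D.obj j ⟶ c.pt => h.toFun s b) (hm j)).trans
      (colimDesc_colimMk D c b).symm

lemma exists_holdsAtomic_of_colimStr {X : Type w} {x : X → S} (φ : Sg.Atomic x) {j : J}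
    (a : ∀ i, (D.obj j).carrier (x i))
    (h : (colimStr D).HoldsAtomic (fun i => (colimStrι D j).toFun _ (a i)) φ) :
    ∃ (k : J) (f : j ⟶ k), (D.obj k).HoldsAtomic (fun i => (D.map f).toFun _ (a i)) φ := by
  have := isFiltered_of_isCardinalFiltered J κ
  cases φ with
  | eq s b c =>
    simp only [HoldsAtomic, ← Hom.map_eval] at h ⊢
    exact exists_map_eq_of_colimMk_eq D h
  | rel R b =>
    simp only [HoldsAtomic, ← Hom.map_eval] at h ⊢
    obtain ⟨j', c, hc, hR⟩ := h
    obtain ⟨k, f, g, hfg⟩ := exists_family_map_eq_map D (Sg.relArity_lt R) hc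
    refine ⟨k, g, ?_⟩
    simp only [← hfg]
    exact (D.map f).map_rel R _ hR

lemma exists_holds_of_colimStr {X : Type w} {x : X → S} (φ : Sg.Conj x) {j : J}
    (a : ∀ i, (D.obj j).carrier (x i))
    (h : (colimStr D).Holds (fun i => (colimStrι D j).toFun _ (a i)) φ) :
    ∃ (k : J) (f : j ⟶ k), (D.obj k).Holds (fun i => (D.map f).toFun _ (a i)) φ := by
  choose k f hf using fun i => exists_holdsAtomic_of_colimStr D (φ.atom i) a (h i)
  obtain ⟨m, g, g', hg⟩ := IsCardinalFiltered.wideSpan f φ.index_lt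
  refine ⟨m, g', fun i => ?_⟩
  rw [← hg i]
  simp only [map_comp_toFun]
  exact Hom.map_holdsAtomic (D.map (g i)) (hf i)

omit hκ [IsCardinalFiltered J κ] in
lemma holds_map_comp {X : Type w} {x : X → S} {φ : Sg.Conj x} {i j k : J} {f : i ⟶ j}
    (g : j ⟶ k) {a : ∀ l, (D.obj i).carrier (x l)}
    (h : (D.obj j).Holds (fun l => (D.map f).toFun _ (a l)) φ) :
    (D.obj k).Holds (fun l => (D.map (f ≫ g)).toFun _ (a l)) φ := by
  simp only [map_comp_toFun]
  exact Hom.map_holds (D.map g) h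

lemma satisfies_colimStr {σ : Sg.LimitSentence} (hσ : ∀ j, (D.obj j).Satisfies σ) :
    (colimStr D).Satisfies σ := by
  have hκ₀ : Cardinal.aleph0 ≤ κ := hκ.out.aleph0_le
  intro a ha
  obtain ⟨j, a', ha'⟩ := exists_family_colimMk_eq D σ.X_lt a
  obtain rfl : (fun i => colimMk D j (a' i)) = a := funext ha'
  -- Existence: the premise already holds at a stage `k`, where a solution exists and can be pushed
  -- to the colimit.
  obtain ⟨k, f, hf⟩ := exists_holds_of_colimStr D _ a' ha
  obtain ⟨b, hb, -⟩ := hσ k _ hf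
  refine existsUnique_of_exists_of_unique ⟨fun i => (colimStrι D k).toFun _ (b i), ?_⟩ ?_
  · have := Hom.map_holds_append (colimStrι D k) hb
    have h : (fun i => (colimStrι D k).toFun _ ((D.map f).toFun _ (a' i))) =
        fun i => colimMk D j (a' i) := funext fun i => colimMk_map D f (a' i)
    rwa [h] at this
  · intro b₁ b₂ h₁ h₂
    -- Uniqueness: since `κ` is infinite, the parameters and both solutions can be represented
    -- together at a single stage `l`.
    have hX : HasCardinalLT (σ.X ⊕ (σ.Y ⊕ σ.Y)) κ := by
      rw [hasCardinalLT_sum_iff _ _ _ hκ₀, hasCardinalLT_sum_iff _ _ _ hκ₀]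
      exact ⟨σ.X_lt, σ.Y_lt, σ.Y_lt⟩
    obtain ⟨l, c, hc⟩ := exists_family_colimMk_eq D hX
      ((colimStr D).append (fun i => colimMk D j (a' i)) ((colimStr D).append b₁ b₂))
    let a₀ (i : σ.X) : (D.obj l).carrier (σ.x i) := c (.inl i)
    let c₁ (i : σ.Y) : (D.obj l).carrier (σ.y i) := c (.inr (.inl i))
    let c₂ (i : σ.Y) : (D.obj l).carrier (σ.y i) := c (.inr (.inr i))
    have ha₀ : (fun i => (colimStrι D l).toFun _ (a₀ i)) = fun i => colimMk D j (a' i) :=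
      funext fun i => hc (.inl i)
    obtain rfl : (fun i => (colimStrι D l).toFun _ (c₁ i)) = b₁ :=
      funext fun i => hc (.inr (.inl i))
    obtain rfl : (fun i => (colimStrι D l).toFun _ (c₂ i)) = b₂ :=
      funext fun i => hc (.inr (.inr i))
    rw [← ha₀] at ha h₁ h₂
    rw [← Hom.map_append] at h₁ h₂
    obtain ⟨k₀, f₀, hf₀⟩ := exists_holds_of_colimStr D _ _ ha
    obtain ⟨k₁, f₁, hf₁⟩ := exists_holds_of_colimStr D _ _ h₁
    obtain ⟨k₂, f₂, hf₂⟩ := exists_holds_of_colimStr D _ _ h₂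
    have := isFiltered_of_isCardinalFiltered J κ
    -- The premise and the two conclusions become true along three different morphisms out of `l`;
    -- these are merged into one morphism to `n`, where uniqueness in `D.obj n` applies.
    obtain ⟨m, g₀, g₁, hg⟩ := IsFiltered.span f₀ f₁
    obtain ⟨n, g, g₂, hg'⟩ := IsFiltered.span (f₀ ≫ g₀) f₂
    replace hf₀ := holds_map_comp D g (holds_map_comp D g₀ hf₀)
    replace hf₁ := holds_map_comp D g (holds_map_comp D g₁ hf₁)
    replace hf₂ := holds_map_comp D g₂ hf₂
    rw [← hg, Hom.map_append] at hf₁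
    rw [← hg', Hom.map_append] at hf₂
    have key := (hσ n _ hf₀).unique hf₁ hf₂
    funext i
    have h := congrArg (fun t => colimMk D n t) (congrFun key i)
    simp only [colimMk_map] at h
    exact h

end Colimits

end Str

/-! ### Accessibility of the underlying-set functors and their left adjoints -/

section Colimits

variable (T : Set Sg.LimitSentence) [Fact κ.IsRegular]

instance isCardinalAccessible_sortProj (t : S) : (sortProj T t).IsCardinalAccessible κ where
  preservesColimitOfShape J _ _ := ⟨fun {F} => by
    let D : J ⥤ Sg.Str := F ⋙ ObjectProperty.ι _
    let L : Mod T := ⟨Str.colimStr D, fun σ hσ =>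
      Str.satisfies_colimStr D fun j => (F.obj j).property σ hσ⟩
    let c : Cocone F :=
      { pt := L
        ι :=
          { app := fun j => ObjectProperty.homMk (Str.colimStrι D j)
            naturality := fun i j f => by
              ext : 1
              exact (Str.colimStrCocone D).ι.naturality f } }
    have hc : IsColimit c := isColimitOfReflects (ObjectProperty.ι _)
      (show IsColimit ((ObjectProperty.ι _).mapCocone c) from Str.isColimitColimStrCocone D)
    exact preservesColimit_of_preserves_colimit_cocone hc
      (IsColimit.ofIsoColimit (colimit.isColimit (D ⋙ Str.sort Sg t))
        (Cocone.ext (Iso.refl _) (fun j => rfl)))⟩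

/-- The functors `sortProj` are right adjoints if the category of models is locally presentable. -/
lemma isRightAdjoint_sortProj [IsCardinalLocallyPresentable (Mod T) κ] (t : S) :
    (sortProj T t).IsRightAdjoint :=
  isRightAdjoint_of_preservesLimits_of_solutionSetCondition _
    (solutionSetCondition_of_isCardinalAccessible κ _)

end Colimits

/-! ### Categories of models with underlying sets of bounded cardinality -/

namespace Str

/-- Inverse maps preserve operations automatically, but preserve relations only if these are
reflected, whence `hrel`. -/
lemma isIso_of_bijective {M N : Sg.Str} (h : M ⟶ N) (hbij : ∀ s, Function.Bijective (h.toFun s))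
    (hrel : ∀ R (a : ∀ i : Sg.relArity R, M.carrier (Sg.relDom R i)),
      N.rel R (fun i => h.toFun _ (a i)) → M.rel R a) : IsIso h := by
  let E (s : S) : M.carrier s ≃ N.carrier s := Equiv.ofBijective _ (hbij s)
  have hE (s : S) (b : N.carrier s) : h.toFun s ((E s).symm b) = b := (E s).apply_symm_apply b
  let g : N ⟶ M :=
    { toFun := fun s => (E s).symm
      map_op := fun f a => (hbij _).injective (by rw [hE, h.map_op]; simp only [hE])
      map_rel := fun R a ha => hrel R _ (by simpa only [hE] using ha) }
  exact ⟨g, hom_ext fun s a => (E s).symm_apply_apply a, hom_ext fun s b => hE s b⟩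

/-- The structure transported along bijections of the underlying sets. -/
def transport (M : Sg.Str) {c : S → Type w} (E : ∀ s, M.carrier s ≃ c s) : Sg.Str where
  carrier := c
  op f a := E _ (M.op f fun i => (E _).symm (a i))
  rel R a := M.rel R fun i => (E _).symm (a i)

/-- The isomorphism from a structure to a transported structure. -/
def isoTransport (M : Sg.Str) {c : S → Type w} (E : ∀ s, M.carrier s ≃ c s) :
    M ≅ M.transport E where
  hom :=
    { toFun := fun s => E s
      map_op := fun f a => by simp [transport]
      map_rel := fun R a ha => by simpa [transport] using ha }
  inv :=
    { toFun := fun s => (E s).symm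
      map_op := fun f a => by simp [transport]
      map_rel := fun R a ha => ha }
  hom_inv_id := hom_ext fun s a => (E s).symm_apply_apply a
  inv_hom_id := hom_ext fun s a => (E s).apply_symm_apply a

lemma Satisfies.of_iso {M N : Sg.Str} (e : M ≅ N) {σ : Sg.LimitSentence} (h : M.Satisfies σ) :
    N.Satisfies σ := by
  have hinv (s : S) (b : N.carrier s) : e.hom.toFun s (e.inv.toFun s b) = b := by
    rw [← comp_toFun, e.inv_hom_id, id_toFun]
  intro a ha
  obtain ⟨b, hb, hb'⟩ := h _ (Hom.map_holds e.inv ha)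
  refine ⟨fun i => e.hom.toFun _ (b i), ?_, fun b' hb'' => ?_⟩
  · simpa only [hinv] using Hom.map_holds_append e.hom hb
  · rw [← hb' _ (Hom.map_holds_append e.inv hb'')]
    simp only [hinv]

end Str

/-- If the underlying sets of the models of a limit theory have bounded cardinality, then there is
only a small set of isomorphism classes of models. -/
lemma essentiallySmall_mod (T : Set Sg.LimitSentence)
    (hT : ∀ t, ¬ HasArbitrarilyLargeValues (sortProj T t)) : EssentiallySmall.{w} (Mod T) := by
  simp only [HasArbitrarilyLargeValues, not_forall, not_exists, not_le] at hT
  choose α hα using hT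
  -- Codes for structures carried by subsets of the fixed sets `(α s).out`. They form a type in `w`,
  -- and transport of structure shows that every model is isomorphic to a coded one.
  let I : Type w := Σ (c : ∀ s, Set (α s).out),
    (∀ f : Sg.Op, (∀ i : Sg.opArity f, c (Sg.opDom f i)) → c (Sg.opCod f)) ×
    (∀ R : Sg.Rel, (∀ i : Sg.relArity R, c (Sg.relDom R i)) → Prop)
  let str (i : I) : Sg.Str := ⟨fun s => i.1 s, i.2.1, i.2.2⟩
  let I' : Type w := { i : I // ∀ σ ∈ T, (str i).Satisfies σ }
  let φ (i : I') : Skeleton (Mod T) := toSkeleton (⟨str i.1, i.2⟩ : Mod T)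
  rw [essentiallySmall_iff]
  refine ⟨small_of_surjective (f := φ) fun M => ?_, inferInstance⟩
  induction M using Quotient.inductionOn with | _ M
  have hemb (s : S) : Nonempty (M.obj.carrier s ↪ (α s).out) := by
    rw [← Cardinal.le_def, Cardinal.mk_out]
    exact (hα s M).le
  let E (s : S) : M.obj.carrier s ≃ Set.range (hemb s).some :=
    Equiv.ofInjective _ (hemb s).some.injective
  let N : Sg.Str := M.obj.transport E
  have hN : ∀ σ ∈ T, N.Satisfies σ := fun σ hσ =>
    (M.property σ hσ).of_iso (M.obj.isoTransport E)
  exact ⟨⟨⟨fun s => Set.range (hemb s).some, N.op, N.rel⟩, hN⟩, toSkeleton_eq_toSkeleton_iff.2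
    ⟨(ObjectProperty.isoMk _ (M.obj.isoTransport E)).symm⟩⟩

end Signature

/-! ### Locally presentable categories as categories of models of limit theories -/

section Presheaf

variable (A : Type w) [SmallCategory A] (κ : Cardinal.{w}) [hκ : Fact κ.IsRegular]

/-- The signature of presheaves of sets on `A`: the sorts are the objects of `A`, and there is a
unary operation for each morphism of `A`. -/
def presheafSignature : Signature A κ where
  Op := Σ a b : A, (a ⟶ b)
  opArity _ := PUnit
  opArity_lt _ := hasCardinalLT_of_finite _ _ hκ.out.aleph0_le
  opDom f _ := f.2.1
  opCod f := f.1
  Rel := PEmpty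
  relArity R := R.elim
  relArity_lt R := R.elim
  relDom R := R.elim

namespace presheafSignature

variable {A κ}

/-- The action of a morphism of `A` on a structure for `presheafSignature A κ`. -/
def act (M : (presheafSignature A κ).Str) {a b : A} (f : a ⟶ b) (x : M.carrier b) : M.carrier a :=
  M.op ⟨a, b, f⟩ (fun _ => x)

/-- The term given by the action of a morphism of `A` on a term. -/
def actTerm {X : Type w} {x : X → A} {a b : A} (f : a ⟶ b)
    (t : (presheafSignature A κ).Term x b) : (presheafSignature A κ).Term x a :=
  .app (Sg := presheafSignature A κ) ⟨a, b, f⟩ (fun _ => t)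

lemma map_act {M N : (presheafSignature A κ).Str} (h : M ⟶ N) {a b : A} (f : a ⟶ b)
    (x : M.carrier b) : h.toFun a (act M f x) = act N f (h.toFun b x) :=
  h.map_op ⟨a, b, f⟩ (fun _ => x)

/-- A homomorphism of structures for `presheafSignature A κ`. -/
def homMk {M N : (presheafSignature A κ).Str} (φ : ∀ a, M.carrier a → N.carrier a)
    (hφ : ∀ {a b : A} (f : a ⟶ b) (x : M.carrier b), φ a (act M f x) = act N f (φ b x)) :
    M ⟶ N where
  toFun := φ
  map_op f x := hφ f.2.2 (x ⟨⟩)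
  map_rel R := R.elim

/-- A variable of the first string, as a term over the concatenation of two strings. -/
def varLeft {X Y : Type w} {x : X → A} (y : Y → A) (i : X) :
    (presheafSignature A κ).Term (Sum.elim x y) (x i) :=
  .var (Sg := presheafSignature A κ) (x := Sum.elim x y) (Sum.inl i)

/-- A variable of the second string, as a term over the concatenation of two strings. -/
def varRight {X Y : Type w} (x : X → A) {y : Y → A} (j : Y) :
    (presheafSignature A κ).Term (Sum.elim x y) (y j) :=
  .var (Sg := presheafSignature A κ) (x := Sum.elim x y) (Sum.inr j)

/-- The limit sentence `(∀ x) t(x) = t'(x)` in a single variable of sort `a`. -/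
def equation (κ : Cardinal.{w}) [hκ : Fact κ.IsRegular] {a b : A}
    (t t' : (presheafSignature A κ).Term
      (Sum.elim (fun _ : PUnit.{w + 1} => a) (PEmpty.elim : PEmpty.{w + 1} → A)) b) :
    (presheafSignature A κ).LimitSentence where
  X := PUnit
  X_lt := hasCardinalLT_of_finite _ _ hκ.out.aleph0_le
  x _ := a
  Y := PEmpty
  Y_lt := hasCardinalLT_of_finite _ _ hκ.out.aleph0_le
  y := PEmpty.elim
  premise := ⟨PEmpty, hasCardinalLT_of_finite _ _ hκ.out.aleph0_le, fun i => i.elim⟩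
  conclusion := ⟨PUnit, hasCardinalLT_of_finite _ _ hκ.out.aleph0_le, fun _ => .eq b t t'⟩

lemma satisfies_equation_iff (M : (presheafSignature A κ).Str) {a b : A}
    (t t' : (presheafSignature A κ).Term
      (Sum.elim (fun _ : PUnit.{w + 1} => a) (PEmpty.elim : PEmpty.{w + 1} → A)) b) :
    M.Satisfies (equation κ t t') ↔ ∀ x : M.carrier a,
      M.eval (M.append (fun _ => x) (fun j => j.elim)) t =
        M.eval (M.append (fun _ => x) (fun j => j.elim)) t' := by
  constructor
  · intro h x
    obtain ⟨y, hy, -⟩ := h (fun _ => x) (fun i => i.elim)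
    obtain rfl : y = fun j => j.elim := funext fun j => j.elim
    exact hy ⟨⟩
  · intro h x _
    exact ⟨fun j => j.elim, fun _ => h (x ⟨⟩), fun y _ => funext fun j => j.elim⟩

variable (κ) in
/-- The limit sentence saying that the identity of `a` acts as the identity. -/
def idSentence (a : A) : (presheafSignature A κ).LimitSentence :=
  equation κ (a := a) (b := a) (actTerm (𝟙 a) (varLeft _ ⟨⟩)) (varLeft _ ⟨⟩)

lemma satisfies_idSentence_iff (M : (presheafSignature A κ).Str) (a : A) :
    M.Satisfies (idSentence κ a) ↔ ∀ x : M.carrier a, act M (𝟙 a) x = x :=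
  satisfies_equation_iff M _ _

variable (κ) in
/-- The limit sentence saying that a composition acts as a composition. -/
def compSentence {a b c : A} (f : a ⟶ b) (g : b ⟶ c) : (presheafSignature A κ).LimitSentence :=
  equation κ (a := c) (b := a) (actTerm (f ≫ g) (varLeft _ ⟨⟩))
    (actTerm f (actTerm g (varLeft _ ⟨⟩)))

lemma satisfies_compSentence_iff (M : (presheafSignature A κ).Str) {a b c : A} (f : a ⟶ b)
    (g : b ⟶ c) : M.Satisfies (compSentence κ f g) ↔
      ∀ x : M.carrier c, act M (f ≫ g) x = act M f (act M g x) :=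
  satisfies_equation_iff M _ _

/-- The limit sentence saying that a presheaf sends a cocone to a limit cone. -/
def coconeSentence {J : Type w} [SmallCategory J] (hJ : HasCardinalLT (Arrow J) κ) {D : J ⥤ A}
    (c : Cocone D) : (presheafSignature A κ).LimitSentence where
  X := J
  X_lt := hasCardinalLT_of_hasCardinalLT_arrow hJ
  x j := D.obj j
  Y := PUnit
  Y_lt := hasCardinalLT_of_finite _ _ hκ.out.aleph0_le
  y _ := c.pt
  premise := ⟨Arrow J, hJ, fun u =>
    .eq (D.obj u.left) (actTerm (D.map u.hom) (.var u.right)) (.var u.left)⟩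
  conclusion := ⟨J, hasCardinalLT_of_hasCardinalLT_arrow hJ, fun j =>
    .eq (D.obj j) (actTerm (c.ι.app j) (varRight D.obj (y := fun _ : PUnit.{w + 1} => c.pt) ⟨⟩))
      (varLeft _ j)⟩

lemma satisfies_coconeSentence_iff (M : (presheafSignature A κ).Str) {J : Type w}
    [SmallCategory J] (hJ : HasCardinalLT (Arrow J) κ) {D : J ⥤ A} (c : Cocone D) :
    M.Satisfies (coconeSentence hJ c) ↔ ∀ x : (∀ j, M.carrier (D.obj j)),
      (∀ ⦃i j : J⦄ (u : i ⟶ j), act M (D.map u) (x j) = x i) →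
      ∃! y : M.carrier c.pt, ∀ j, act M (c.ι.app j) y = x j := by
  constructor
  · intro h x hx
    obtain ⟨y, hy, hy'⟩ := h x (fun u => hx u.hom)
    exact ⟨y ⟨⟩, hy, fun z hz => congrFun (hy' (fun _ => z) hz) ⟨⟩⟩
  · intro h x hx
    obtain ⟨y, hy, hy'⟩ := h x (fun i j u => hx (Arrow.mk u))
    exact ⟨fun _ => y, hy, fun z hz => funext fun _ => hy' (z ⟨⟩) hz⟩

end presheafSignature

end Presheaf

/-! ### Filteredness tested on representative shapes, and density -/

/-- Every shape with fewer than `κ` arrows is equivalent to one in a small family of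
representatives; restricting to that family also keeps `presheafSignature.theory` small. -/
lemma isCardinalFiltered_of_nonempty_cocone {J : Type u} [Category.{v} J] (κ : Cardinal.{w})
    [Fact κ.IsRegular] (h : ∀ (s : SmallCategoryCardinalLT κ)
      (F : SmallCategoryCardinalLT.categoryFamily κ s ⥤ J), Nonempty (Cocone F)) :
    IsCardinalFiltered J κ where
  nonempty_cocone {B} _ F hB := by
    obtain ⟨s, ⟨e⟩⟩ := SmallCategoryCardinalLT.exists_equivalence κ B hB
    exact (h s (e.functor ⋙ F)).map fun c =>
      (Cocone.equivalenceOfReindexing e (Iso.refl _)).inverse.obj c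

section Dense

variable {A : Type u} [Category.{v} A] {C : Type u'} [Category.{v'} C] (i : A ⥤ C) [i.IsDense]

lemma hom_ext_of_isDense {K L : C} {g h : K ⟶ L}
    (H : ∀ (a : A) (x : i.obj a ⟶ K), x ≫ g = x ≫ h) : g = h :=
  (i.denseAt K).hom_ext' fun a x => by
    change 𝟙 _ ≫ x ≫ g = 𝟙 _ ≫ x ≫ h
    rw [H]

/-- By density `K` is the canonical colimit of the objects `i.obj a` over it, and a natural `φ` is
exactly a cocone on that diagram. This yields fullness of the nerve. -/
lemma exists_hom_of_isDense {K L : C} (φ : ∀ a : A, (i.obj a ⟶ K) → (i.obj a ⟶ L))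
    (hφ : ∀ {a b : A} (f : a ⟶ b) (x : i.obj b ⟶ K), φ a (i.map f ≫ x) = i.map f ≫ φ b x) :
    ∃ g : K ⟶ L, ∀ (a : A) (x : i.obj a ⟶ K), x ≫ g = φ a x := by
  let c : Cocone (CostructuredArrow.proj i K ⋙ i) :=
    { pt := L
      ι :=
        { app := fun g => φ g.left g.hom
          naturality := fun g₁ g₂ u => by
            have := hφ u.left g₂.hom
            rw [CostructuredArrow.w] at this
            exact this.symm.trans (Category.comp_id _).symm } }
  refine ⟨(i.denseAt K).desc c, fun a x => ?_⟩
  have h : (𝟙 _ ≫ x) ≫ (i.denseAt K).desc c = φ a x :=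
    (i.denseAt K).fac c (CostructuredArrow.mk x)
  rwa [Category.id_comp] at h

end Dense

namespace presheafSignature

variable {A : Type w} [SmallCategory A] {κ : Cardinal.{w}} [hκ : Fact κ.IsRegular]

/-! ### The category of elements -/

/-- The category of elements of a structure for `presheafSignature A κ`. -/
structure Elem (M : (presheafSignature A κ).Str) : Type w where
  /-- the sort of the element -/
  obj : A
  /-- the element -/
  elt : M.carrier obj

/-- A structure for `presheafSignature A κ` is a presheaf if morphisms act functorially. -/
structure IsPresheaf (M : (presheafSignature A κ).Str) : Prop where
  act_id {a : A} (x : M.carrier a) : act M (𝟙 a) x = x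
  act_comp {a b c : A} (f : a ⟶ b) (g : b ⟶ c) (x : M.carrier c) :
    act M (f ≫ g) x = act M f (act M g x)

/-- The category structure on the elements of a presheaf. -/
abbrev elemCategory {M : (presheafSignature A κ).Str} (hM : IsPresheaf M) :
    SmallCategory (Elem M) where
  Hom p q := { f : p.obj ⟶ q.obj // act M f q.elt = p.elt }
  id p := ⟨𝟙 _, hM.act_id _⟩
  comp f g := ⟨f.1 ≫ g.1, by rw [hM.act_comp, g.2, f.2]⟩

/-! ### The theory of presheaves sending a given set of cocones to limit cones -/

section Theory

variable {C : Type u} [Category.{w} C] (i : A ⥤ C)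

variable (κ) in
/-- The cocones in `A` of shape of cardinality `< κ` which become colimit cocones in `C`. -/
structure ColimitIndex : Type w where
  /-- the shape of the cocone -/
  shape : SmallCategoryCardinalLT κ
  /-- the diagram -/
  diag : SmallCategoryCardinalLT.categoryFamily κ shape ⥤ A
  /-- the cocone -/
  cocone : Cocone diag
  nonempty_isColimit : Nonempty (IsColimit (i.mapCocone cocone))

variable (κ) in
/-- The limit theory of the presheaves of sets on `A` which send to limit cones the cocones of
shape of cardinality `< κ` that become colimit cocones in `C`. -/
def theory : Set (presheafSignature A κ).LimitSentence :=
  Set.range (idSentence κ (A := A)) ∪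
    Set.range (fun f : Σ a b c : A, (a ⟶ b) × (b ⟶ c) => compSentence κ f.2.2.2.1 f.2.2.2.2) ∪
    Set.range (fun c : ColimitIndex κ i => coconeSentence c.shape.hasCardinalLT c.cocone)

instance : Small.{w} (theory κ i) := by
  unfold theory
  infer_instance

lemma isPresheaf_of_satisfies {M : (presheafSignature A κ).Str}
    (hM : ∀ σ ∈ theory κ i, M.Satisfies σ) : IsPresheaf M where
  act_id {a} := (satisfies_idSentence_iff M a).1 (hM _ (.inl (.inl ⟨a, rfl⟩)))
  act_comp {a b c} f g := (satisfies_compSentence_iff M f g).1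
    (hM _ (.inl (.inr ⟨⟨a, b, c, f, g⟩, rfl⟩)))

lemma existsUnique_of_satisfies {M : (presheafSignature A κ).Str}
    (hM : ∀ σ ∈ theory κ i, M.Satisfies σ) (c : ColimitIndex κ i)
    (x : ∀ j, M.carrier (c.diag.obj j))
    (hx : ∀ ⦃j k⦄ (u : j ⟶ k), act M (c.diag.map u) (x k) = x j) :
    ∃! y : M.carrier c.cocone.pt, ∀ j, act M (c.cocone.ι.app j) y = x j :=
  (satisfies_coconeSentence_iff M c.shape.hasCardinalLT c.cocone).1 (hM _ (.inr ⟨c, rfl⟩)) x hx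

variable (κ) in
/-- The presheaf on `A` represented by an object of `C`. -/
def nerveStr (K : C) : (presheafSignature A κ).Str where
  carrier a := i.obj a ⟶ K
  op f x := i.map f.2.2 ≫ x ⟨⟩
  rel R := R.elim

lemma satisfies_nerveStr (K : C) : ∀ σ ∈ theory κ i, (nerveStr κ i K).Satisfies σ := by
  rintro _ ((⟨a, rfl⟩ | ⟨⟨a, b, c, f, g⟩, rfl⟩) | ⟨c, rfl⟩)
  · rw [satisfies_idSentence_iff]
    intro x
    exact (congrArg (· ≫ x) (i.map_id a)).trans (Category.id_comp (Y := K) x)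
  · rw [satisfies_compSentence_iff]
    intro x
    exact (congrArg (· ≫ x) (i.map_comp f g)).trans (Category.assoc (Z := K) _ _ x)
  · rw [satisfies_coconeSentence_iff]
    intro x hx
    -- A compatible family in the nerve is a cocone with vertex `K` over the image diagram, so the
    -- colimit property in `C` gives the unique element.
    have hc := c.nonempty_isColimit.some
    let d : Cocone (c.diag ⋙ i) :=
      { pt := K
        ι :=
          { app := x
            naturality := fun j k u => (hx u).trans (Category.comp_id _).symm } }
    exact ⟨hc.desc d, fun j => hc.fac d j, fun y hy => hc.uniq d y hy⟩

variable (κ) in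
/-- The functor sending an object of `C` to the presheaf on `A` it represents. -/
def nerve : C ⥤ Signature.Mod (theory κ i) where
  obj K := ⟨nerveStr κ i K, satisfies_nerveStr i K⟩
  map {K L} g := ObjectProperty.homMk (homMk (M := nerveStr κ i K) (N := nerveStr κ i L)
    (fun a x => x ≫ g) (fun f x => Category.assoc _ _ _))
  map_id K := by
    ext : 1
    exact Signature.Str.hom_ext fun a x => Category.comp_id _
  map_comp g h := by
    ext : 1
    exact Signature.Str.hom_ext fun a x => (Category.assoc _ _ _).symm

instance [i.IsDense] : (nerve κ i).Faithful where
  map_injective {K L} g h e := by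
    exact hom_ext_of_isDense i fun a x =>
      congrArg (fun t : (nerve κ i).obj K ⟶ (nerve κ i).obj L => t.hom.toFun a x) e

instance [i.IsDense] : (nerve κ i).Full where
  map_surjective {K L} φ := by
    let h : nerveStr κ i K ⟶ nerveStr κ i L := φ.hom
    obtain ⟨g, hg⟩ := exists_hom_of_isDense i (L := L) (fun a x => h.toFun a x)
      (fun f x => map_act h f x)
    exact ⟨g, ObjectProperty.hom_ext _ (Signature.Str.hom_ext fun a x => hg a x)⟩

/-- A model `M` should be the nerve of the colimit of `i` over its category of elements. That
category is `κ`-filtered because `M` sends the cocones supplied by `hi` to limit cones, so elements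
over a `κ`-small diagram glue. Presentability of the `i.obj a` then identifies maps into the colimit
with elements of `M`. -/
lemma essSurj_nerve [i.Full] [i.Faithful] [HasColimitsOfSize.{w, w} C]
    [∀ a, IsCardinalPresentable (i.obj a) κ]
    (hi : ∀ (s : SmallCategoryCardinalLT κ)
      (D : SmallCategoryCardinalLT.categoryFamily κ s ⥤ A),
      ∃ c : Cocone D, Nonempty (IsColimit (i.mapCocone c))) : (nerve κ i).EssSurj where
  mem_essImage M := by
    have hM := isPresheaf_of_satisfies i M.property
    let _ : SmallCategory (Elem M.obj) := elemCategory hM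
    have : IsCardinalFiltered (Elem M.obj) κ := isCardinalFiltered_of_nonempty_cocone κ
      fun s F => by
        let D : SmallCategoryCardinalLT.categoryFamily κ s ⥤ A :=
          { obj := fun j => (F.obj j).obj
            map := fun u => (F.map u).1
            map_id := fun j => by rw [F.map_id]; rfl
            map_comp := fun u v => by rw [F.map_comp]; rfl }
        obtain ⟨c, hc⟩ := hi s D
        obtain ⟨y, hy, -⟩ := existsUnique_of_satisfies i M.property ⟨s, D, c, hc⟩
          (fun j => (F.obj j).elt) (fun j k u => (F.map u).2)
        exact ⟨{ pt := ⟨c.pt, y⟩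
                 ι := { app := fun j => ⟨c.ι.app j, hy j⟩
                        naturality := fun j k u => Subtype.ext (c.ι.naturality u) } }⟩
    let P : Elem M.obj ⥤ C :=
      { obj := fun p => i.obj p.obj
        map := fun f => i.map f.1
        map_id := fun p => i.map_id _
        map_comp := fun f g => i.map_comp _ _ }
    have hP := colimit.isColimit P
    let ι {a : A} (x : M.obj.carrier a) : i.obj a ⟶ colimit P := colimit.ι P ⟨a, x⟩
    have hι {a b : A} (f : a ⟶ b) (x : M.obj.carrier b) : ι (act M.obj f x) = i.map f ≫ ι x :=
      (colimit.w P (show (⟨a, act M.obj f x⟩ : Elem M.obj) ⟶ ⟨b, x⟩ from ⟨f, rfl⟩)).symm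
    let h : M.obj ⟶ nerveStr κ i (colimit P) := homMk (fun a x => ι x) (fun f x => hι f x)
    have := essentiallySmallSelf (Elem M.obj)
    have : IsIso h := by
      refine Signature.Str.isIso_of_bijective h (fun a => ⟨fun x y hxy => ?_, fun g => ?_⟩)
        (fun R => R.elim)
      -- If `x` and `y` induce the same map to the colimit, that equality is witnessed at a stage
      -- `p`. Faithfulness of `i` identifies `u` and `v`, and both elements are the restriction of
      -- `p.elt` along this morphism.
      · obtain ⟨p, u, v, huv⟩ := IsCardinalPresentable.exists_eq_of_isColimit κ hP
          (i₁ := ⟨a, x⟩) (i₂ := ⟨a, y⟩) (𝟙 (i.obj a)) (𝟙 (i.obj a))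
          (by
            have hxy' : ι x = ι y := hxy
            exact congrArg (fun t => 𝟙 (i.obj a) ≫ t) hxy')
        have huv' : i.map u.1 = i.map v.1 := by
          simpa only [Category.id_comp] using
            (show 𝟙 (i.obj a) ≫ i.map u.1 = 𝟙 (i.obj a) ≫ i.map v.1 from huv)
        have h₁ : act M.obj u.1 p.elt = x := u.2
        have h₂ : act M.obj v.1 p.elt = y := v.2
        rw [← h₁, ← h₂, i.map_injective huv']
      · obtain ⟨p, f, hf⟩ := IsCardinalPresentable.exists_hom_of_isColimit (X := i.obj a) κ hP g
        obtain ⟨f', rfl⟩ := i.map_surjective (X := a) (Y := p.obj) f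
        exact ⟨act M.obj f' p.elt, (hι f' p.elt).trans hf⟩
    let e : M.obj ≅ nerveStr κ i (colimit P) := asIso h
    exact ⟨colimit P, ⟨(ObjectProperty.isoMk _ (X := M) (Y := (nerve κ i).obj _) e).symm⟩⟩

end Theory

end presheafSignature

/-! ### The representation theorem -/

/-- A locally `κ`-presentable category with small hom-sets is equivalent to the category of models
of a limit theory. -/
lemma exists_nonempty_equivalence_mod_of_smallHoms (C : Type u) [Category.{w} C]
    (κ : Cardinal.{w}) [Fact κ.IsRegular] [IsCardinalLocallyPresentable C κ] :
    ∃ (S : Type w) (Sg : Signature S κ) (T : Set Sg.LimitSentence),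
      Small.{w} T ∧ Nonempty (C ≌ Signature.Mod T) := by
  let P := isCardinalPresentable C κ
  let e := equivSmallModel.{w} P.FullSubcategory
  let i : SmallModel.{w} P.FullSubcategory ⥤ C := e.inverse ⋙ P.ι
  have : ∀ a, IsCardinalPresentable (i.obj a) κ := fun a => (e.inverse.obj a).property
  have : i.IsDense := inferInstanceAs (e.inverse ⋙ P.ι).IsDense
  have hi (s : SmallCategoryCardinalLT κ)
      (D : SmallCategoryCardinalLT.categoryFamily κ s ⥤ SmallModel.{w} P.FullSubcategory) :
      ∃ c : Cocone D, Nonempty (IsColimit (i.mapCocone c)) := by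
    -- Closure of `κ`-presentable objects under `κ`-small colimits provides the colimit cocones in
    -- the small model that remain colimits in `C`.
    have : P.IsClosedUnderColimitsOfShape (SmallCategoryCardinalLT.categoryFamily κ s) :=
      isClosedUnderColimitsOfShape_isCardinalPresentable C s.hasCardinalLT
    have : HasColimit D := Adjunction.hasColimit_of_comp_equivalence D e.inverse
    exact ⟨colimit.cocone D, ⟨isColimitOfPreserves P.ι
      (isColimitOfPreserves e.inverse (colimit.isColimit D))⟩⟩
  have := presheafSignature.essSurj_nerve (κ := κ) i hi
  have : (presheafSignature.nerve κ i).IsEquivalence := { }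
  exact ⟨_, presheafSignature _ κ, presheafSignature.theory κ i, inferInstance,
    ⟨(presheafSignature.nerve κ i).asEquivalence⟩⟩

/-- A locally `κ`-presentable category is equivalent to the category of models of a limit
theory. -/
lemma exists_nonempty_equivalence_mod (C : Type u) [Category.{v} C]
    (κ : Cardinal.{w}) [Fact κ.IsRegular] [IsCardinalLocallyPresentable C κ] :
    ∃ (S : Type w) (Sg : Signature S κ) (T : Set Sg.LimitSentence),
      Small.{w} T ∧ Nonempty (C ≌ Signature.Mod T) := by
  -- The nerve takes hom-sets as carriers, which must therefore lie in `Type w`.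
  let e := ShrinkHoms.equivalence.{w} C
  have := e.isCardinalLocallyPresentable κ
  obtain ⟨S, Sg, T, hT, ⟨e'⟩⟩ := exists_nonempty_equivalence_mod_of_smallHoms (ShrinkHoms C) κ
  exact ⟨S, Sg, T, hT, ⟨e.trans e'⟩⟩

/-! ### Unbounded sorts and preservation of presentability ranks -/

section

variable {C : Type u} [Category.{v} C] {κ : Cardinal.{w}} {S : Type w} {Sg : Signature S κ}
  {T : Set Sg.LimitSentence} (e : C ≌ Signature.Mod T)

include e

/-- If a category of models of a limit theory is large, then the underlying sets of some sort have
arbitrarily large cardinality. -/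
lemma exists_hasArbitrarilyLargeValues (large : ¬ EssentiallySmall.{w} C) :
    ∃ t : S, HasArbitrarilyLargeValues (e.functor ⋙ Signature.sortProj T t) := by
  by_contra! h
  refine large ((essentiallySmall_congr e).2 (Signature.essentiallySmall_mod T fun t ht => h t ?_))
  intro α
  obtain ⟨M, hM⟩ := ht α
  refine ⟨e.inverse.obj M, hM.trans_eq (Cardinal.mk_congr ?_)⟩
  exact ((Signature.sortProj T t).mapIso (e.counitIso.app M)).symm.toEquiv

variable [Fact κ.IsRegular]

/-- Local presentability of `Mod T` is not derived from `T` but transported from `C` along `e`. -/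
lemma isRightAdjoint_comp_sortProj [IsCardinalLocallyPresentable C κ] (t : S) :
    (e.functor ⋙ Signature.sortProj T t).IsRightAdjoint := by
  have := e.isCardinalLocallyPresentable κ
  have := Signature.isRightAdjoint_sortProj T t
  infer_instance

lemma preservesPresentabilityRanksFrom_of_adjunction_comp_sortProj {t : S}
    (ht : HasArbitrarilyLargeValues (e.functor ⋙ Signature.sortProj T t)) {F : Type w ⥤ C}
    (adj : F ⊣ e.functor ⋙ Signature.sortProj T t) : PreservesPresentabilityRanksFrom F κ := by
  obtain ⟨K, hK⟩ := ht.exists_nontrivial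
  exact preservesPresentabilityRanksFrom_of_adjunction adj (K := K) κ

end

theorem theorem4p6 {C : Type u} [Category.{v} C] [IsLocallyPresentable.{w} C]
    (large : ¬ EssentiallySmall.{w} C) :
    IsLSAccessible.{w} C ∧
    ∀ (κ : Cardinal.{w}) [Fact κ.IsRegular] [IsCardinalLocallyPresentable C κ],
      (∃ (S : Type w) (Sg : Signature S κ) (T : Set Sg.LimitSentence),
        Small.{w} T ∧ Nonempty (C ≌ Signature.Mod T)) ∧
      ∀ (S : Type w) (Sg : Signature S κ) (T : Set Sg.LimitSentence) [Small.{w} T]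
        (e : C ≌ Signature.Mod T),
        (∃ t : S, HasArbitrarilyLargeValues (e.functor ⋙ Signature.sortProj T t)) ∧
        ∀ t : S, HasArbitrarilyLargeValues (e.functor ⋙ Signature.sortProj T t) →
          (∃ F : Type w ⥤ C, Nonempty (F ⊣ e.functor ⋙ Signature.sortProj T t)) ∧
          ∀ F : Type w ⥤ C, Nonempty (F ⊣ e.functor ⋙ Signature.sortProj T t) →
            PreservesPresentabilityRanksFrom F κ := by
  refine ⟨?_, fun κ _ _ => ⟨exists_nonempty_equivalence_mod C κ, fun S Sg T _ e =>
    ⟨exists_hasArbitrarilyLargeValues e large, fun t ht => ⟨?_, fun F ⟨adj⟩ =>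
      preservesPresentabilityRanksFrom_of_adjunction_comp_sortProj e ht adj⟩⟩⟩⟩
  · obtain ⟨κ, hκ, _⟩ := IsLocallyPresentable.exists_cardinal.{w} C
    obtain ⟨S, Sg, T, _, ⟨e⟩⟩ := exists_nonempty_equivalence_mod C κ
    obtain ⟨t, ht⟩ := exists_hasArbitrarilyLargeValues e large
    have := isRightAdjoint_comp_sortProj e t
    have hF := preservesPresentabilityRanksFrom_of_adjunction_comp_sortProj e ht
      (Adjunction.ofIsRightAdjoint (e.functor ⋙ Signature.sortProj T t))
    refine ⟨κ, inferInstance, fun μ hμ => ?_⟩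
    -- A set of cardinality `μ ≥ κ` is infinite and has rank `μ⁺`; its image under the left adjoint
    -- is the required object.
    have h := hasPresentabilityRank_type_succ μ.out
      (by rw [Cardinal.mk_out]; exact hκ.out.aleph0_le.trans hμ)
    rw [Cardinal.mk_out] at h
    exact ⟨_, hF _ (hμ.trans (Order.le_succ μ)) _ h⟩
  · have := isRightAdjoint_comp_sortProj e t
    exact ⟨_, ⟨Adjunction.ofIsRightAdjoint (e.functor ⋙ Signature.sortProj T t)⟩⟩
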